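/- **Learning the predictable process with partial information about the models.** Let $\mathcal B$ be a real normed space (e.g. a Banach space) with norm $\|\cdot\|$ and dual norm $\|\cdot\|_*$. Let $\mathcal F\subset\mathcal B$ and $\mathcal X\subset\mathcal B^*$ be convex sets contained in the respective unit balls, let $\mathcal R:\mathcal B\to\mathbb R$ be $1$-strongly convex on $\mathcal F$ with respect to $\|\cdot\|$ and bounded above on $\mathcal F$, put $R_{\max}^2=\sup_{\mathcal F}\mathcal R-\inf_{\mathcal F}\mathcal R$, and let $D_{\mathcal R}(f,g)=\mathcal R(f)-\mathcal R(g)-\langle f-g,\nabla\mathcal R(g)\rangle$, where $\nabla\mathcal R(g)$ is a (Gateaux) gradient relative to $\mathcal F$. Let $\Pi=\{1,\dots,d\}$, $d\ge 2$, $T\ge 1$, $\eta>0$. In round $t$ Nature has a loss vector $x_t\in\mathcal X$ and model $\pi\in\Pi$ has a prediction $M_t^\pi\in\mathcal B^*$, $\|M_t^\pi\|_*\le1$; both may depend on the learner's random draws of the earlier rounds, and on Nature's own randomness, which is independent of the learner's draws. The learner sees $x_t$ at the end of round $t$, but only one prediction $M_t^{\pi_t}$. The learner starts with $g_1\in\arg\min_{g\in\mathcal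 F}\mathcal R(g)$ and in round $t=1,\dots,T$ proceeds as follows. 1. (SCRiBLe for multi-armed bandits, step $\gamma=1/(32d^2)$.) Let $\mathcal S(h)=-\sum_{i<d}\log h[i]-\log(1-\sum_{i<d}h[i])$ on the open simplex $\Delta^\circ=\{h\in\mathbb R^{d-1}:h[i]>0,\ \sum_i h[i]<1\}$, and $h_t=\arg\min_{h\in\Delta^\circ}\ \gamma\langle h,\sum_{s<t}\tilde x_s\rangle+\mathcal S(h)$ (so $h_1$ is uniform). Let $v_1,\dots,v_{d-1}$ be an orthonormal basis of eigenvectors of $\nabla^2\mathcal S(h_t)$ with eigenvalues $\lambda_1,\dots,\lambda_{d-1}$. Draw $i_t\in\{1,\dots,d-1\}$ and $\varepsilon_t\in\{-1,1\}$ uniformly and independently, let $u_t=h_t+\varepsilon_t\lambda_{i_t}^{-1/2}v_{i_t}$ and $q_t=(u_t,1-\sum_i u_t[i])$, draw $\pi_t\sim q_t$, and set $\tilde x_t=d\,\|x_t-M_t^{\pi_t}\|_*^2\,\varepsilon_t\lambda_{i_t}^{1/2}v_{i_t}$. 2. (Optimistic mirror descent.) Predict $f_t\in\arg\min_{f\in\mathcal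 F}\eta\langle f,M_t^{\pi_t}\rangle+D_{\mathcal R}(f,g_t)$, observe $x_t$, and let $g_{t+1}\in\arg\min_{g\in\mathcal F}\eta\langle g,x_t\rangle+D_{\mathcal R}(g,g_t)$. (These minimizers, and the gradients $\nabla\mathcal R(g_t)$, are assumed to exist.) Then for every $f^*\in\mathcal F$, and for any such strategy of Nature, $$\mathbb E\Big[\sum_{t=1}^T\langle f_t,x_t\rangle\Big]-\mathbb E\Big[\sum_{t=1}^T\langle f^*,x_t\rangle\Big]\le \eta^{-1}R_{\max}^2+\frac\eta2\,\mathbb E\Big[\sum_{t=1}^T\|x_t-M_t^{\pi_t}\|_*^2\Big].$$ If moreover Nature is oblivious, that is, $x_t$ and $M_t^\pi$ do not depend on the learner's draws (they may be random, independently of those draws, and $M_t^\pi$ may depend on $x_1,\dots,x_{t-1}$), then the right-hand side is at most $$\eta^{-1}R_{\max}^2+\eta\Big(\mathbb E\inf_{\pi\in\Pi}\sum_{t=1}^T\|x_t-M_t^\pi\|_*^2+32\,|\Pi|^3\log(T|\Pi|)\Big).$$ -/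

import Mathlib

open MeasureTheory

noncomputable section

namespace OptimisticMD

/-! ### Regularizer, Bregman divergence, mirror step -/

section Mirror

variable {B : Type*} [NormedAddCommGroup B] [NormedSpace ℝ B]

/-- One-sided directional derivative of `R` at `g` in the direction `v`. -/
def dirDeriv (R : B → ℝ) (g v : B) : ℝ :=
  derivWithin (fun s : ℝ => R (g + s • v)) (Set.Ici 0) 0

/-- `R` has a gradient at `g` relative to the set `F`: the directional derivatives towards the
points of `F` exist and are given by one continuous linear functional.  This holds whenever `R` is
Fréchet or Gateaux differentiable at `g`, and it also covers regularizers such as the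
negative entropy at the points of the simplex with positive coordinates. -/
def HasGradientRel (R : B → ℝ) (F : Set B) (g : B) : Prop :=
  ∃ p : StrongDual ℝ B, ∀ f ∈ F,
    HasDerivWithinAt (fun s : ℝ => R (g + s • (f - g))) (p (f - g)) (Set.Ici 0) 0

/-- Bregman divergence `D_R(f, g) = R f - R g - ⟨∇R(g), f - g⟩`. -/
def bregman (R : B → ℝ) (f g : B) : ℝ :=
  R f - R g - dirDeriv R g (f - g)

/-- `a` is a minimizer over `F` of `η ⟨·, y⟩ + D_R(·, c)`. -/
def IsMirrorStep (F : Set B) (R : B → ℝ) (η : ℝ) (y : StrongDual ℝ B) (c a : B) : Prop :=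
  a ∈ F ∧ IsMinOn (fun v => η * y v + bregman R v c) F a

/-- `R_max² = max_F R - min_F R`. -/
def RmaxSq (F : Set B) (R : B → ℝ) : ℝ :=
  sSup (R '' F) - sInf (R '' F)

end Mirror

/-! ### The barrier of the simplex -/

/-- The open simplex in the first `d - 1 = n` coordinates. -/
def openSimplex (n : ℕ) : Set (EuclideanSpace ℝ (Fin n)) :=
  {v | (∀ i, 0 < v i) ∧ ∑ i, v i < 1}

/-- `-∑ log v[i] - log (1 - ∑ v[i])`; only used on the open simplex. -/
def barrier (n : ℕ) (v : EuclideanSpace ℝ (Fin n)) : ℝ :=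
  -(∑ i, Real.log (v i)) - Real.log (1 - ∑ i, v i)

/-- The vectors `b i` form an orthonormal basis of eigenvectors of the Hessian of the barrier at
`v`, with eigenvalues `lam i`. -/
def IsHessianEigenbasis {n : ℕ} (v : EuclideanSpace ℝ (Fin n))
    (b : OrthonormalBasis (Fin n) ℝ (EuclideanSpace ℝ (Fin n))) (lam : Fin n → ℝ) : Prop :=
  ∀ i, fderiv ℝ (fderiv ℝ (barrier n)) v (b i) = lam i • innerSL ℝ (b i)

/-- The distribution `(v, 1 - ∑ v[i])` on the `n + 1` arms. -/
def completeWeights {n : ℕ} (v : EuclideanSpace ℝ (Fin n)) : Fin (n + 1) → ℝ :=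
  Fin.snoc (α := fun _ => ℝ) (fun i => v i) (1 - ∑ i, v i)

/-! ### The game -/

/-- The random choices of one round: the eigenvector index `i_t`, the sign `ε_t`, and the
model `π_t`.  The models are numbered `0, …, n`. -/
structure Draw (n : ℕ) where
  dir : Fin n
  sign : ℤˣ
  model : Fin (n + 1)

/-- What has been drawn in the past rounds, the most recent round first.  A history of length `t`
is what precedes round `t + 1`. -/
abbrev History (n : ℕ) := List (Draw n)

/-- A strategy of Nature together with the iterates of the learner, as functions of the history
before the current round.  The draws of the current round are not available to Nature. -/
structure Play (B : Type*) [NormedAddCommGroup B] [NormedSpace ℝ B] (n : ℕ) where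
  /-- Nature's move `x_t` -/
  x : History n → StrongDual ℝ B
  /-- the predictions `M_t^π` -/
  M : History n → Fin (n + 1) → StrongDual ℝ B
  /-- the secondary iterate `g_t` of mirror descent -/
  g : History n → B
  /-- the prediction `f_t`, as a function of the model `π_t` drawn in round `t` -/
  f : History n → Fin (n + 1) → B
  /-- the iterate `h_t` of the bandit algorithm -/
  h : History n → EuclideanSpace ℝ (Fin n)
  /-- the eigenvectors used in round `t` -/
  e : History n → OrthonormalBasis (Fin n) ℝ (EuclideanSpace ℝ (Fin n))
  /-- the eigenvalues used in round `t` -/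
  lam : History n → Fin n → ℝ

namespace Play

variable {B : Type*} [NormedAddCommGroup B] [NormedSpace ℝ B] {n : ℕ} (p : Play B n)

/-- The loss `‖x_t - M_t^π‖_*²` of the model `π`. -/
def modelLoss (l : History n) (k : Fin (n + 1)) : ℝ := ‖p.x l - p.M l k‖ ^ 2

/-- `q_t`, the completion of `h_t + ε λ_i^{-1/2} e_i` to a distribution on the models. -/
def q (l : History n) (i : Fin n) (s : ℤˣ) : Fin (n + 1) → ℝ :=
  completeWeights (p.h l + (((s : ℤ) : ℝ) * (Real.sqrt (p.lam l i))⁻¹) • p.e l i)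

/-- Conditional probability, given the history, of the draws of the current round: the index and
the sign are uniform, and then the model has distribution `q_t`. -/
def prob (l : History n) (a : Draw n) : ℝ :=
  1 / n * (1 / 2) * p.q l a.dir a.sign a.model

/-- The estimate `d · (loss of the drawn model) · ε λ_i^{1/2} e_i`, where `d = n + 1`.
It uses the prediction of the drawn model only. -/
def estimate (l : History n) (a : Draw n) : EuclideanSpace ℝ (Fin n) :=
  (((n : ℝ) + 1) * p.modelLoss l a.model * ((a.sign : ℤ) : ℝ) * Real.sqrt (p.lam l a.dir)) •
    p.e l a.dir

/-- The sum of the estimates of the past rounds. -/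
def sumEstimates : History n → EuclideanSpace ℝ (Fin n)
  | [] => 0
  | a :: l => sumEstimates l + p.estimate l a

/-- The learner follows Optimistic Mirror Descent with step `η`, with the models drawn by SCRiBLe
for multi-armed bandits with step `1 / (32 d²)`, where `d = n + 1` is the number of models.
(At the empty history, `h_minOn` says that `h_1` is the minimizer of the barrier, which is the
uniform distribution.) -/
structure IsRun (F : Set B) (R : B → ℝ) (η : ℝ) : Prop where
  g_init : p.g [] ∈ F ∧ IsMinOn R F (p.g [])
  g_step : ∀ l a, IsMirrorStep F R η (p.x l) (p.g l) (p.g (a :: l))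
  g_grad : ∀ l, HasGradientRel R F (p.g l)
  f_step : ∀ l k, IsMirrorStep F R η (p.M l k) (p.g l) (p.f l k)
  h_mem : ∀ l, p.h l ∈ openSimplex n
  h_minOn : ∀ l, IsMinOn
    (fun v => 1 / (32 * ((n : ℝ) + 1) ^ 2) * inner ℝ v (p.sumEstimates l) + barrier n v)
    (openSimplex n) (p.h l)
  eigen : ∀ l, IsHessianEigenbasis (p.h l) (p.e l) (p.lam l)

/-- Nature is oblivious: its moves and the predictions of the models depend on the number of the
round, but not on what the learner has drawn. -/
def Oblivious : Prop :=
  ∀ l l' : History n, l.length = l'.length → p.x l = p.x l' ∧ p.M l = p.M l'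

/-- Conditional expectation, given the history `l`, of `Φ` of the history after `T` more rounds. -/
def expectFrom : ℕ → History n → (History n → ℝ) → ℝ
  | 0, l, Φ => Φ l
  | T + 1, l, Φ =>
      ∑ i : Fin n, ∑ s : ℤˣ, ∑ k : Fin (n + 1),
        p.prob l ⟨i, s, k⟩ * expectFrom T (⟨i, s, k⟩ :: l) Φ

end Play

/-- The sum over the rounds of a history of a cost that depends on the round's own past and on the
model drawn in that round. -/
def pathSum {n : ℕ} (c : History n → Fin (n + 1) → ℝ) : History n → ℝ
  | [] => 0
  | a :: l => pathSum c l + c l a.model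

section Random

variable {B : Type*} [NormedAddCommGroup B] [NormedSpace ℝ B] {n : ℕ}
  {S : Type*} [MeasurableSpace S]

/-- Expectation, over Nature's own randomness `s ∼ μ` (which is independent of the learner's
draws) and over the learner's draws in the first `T` rounds. -/
def expectation (μ : Measure S) (p : S → Play B n) (T : ℕ) (Φ : S → History n → ℝ) : ℝ :=
  ∫ s, (p s).expectFrom T [] (Φ s) ∂μ

/-- The scalar quantities of the game are random variables. -/
structure IsMeasurablePlay (μ : Measure S) (F : Set B) (p : S → Play B n) : Prop where
  prob : ∀ l a, AEMeasurable (fun s => (p s).prob l a) μ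
  loss : ∀ l k, AEMeasurable (fun s => (p s).modelLoss l k) μ
  play : ∀ l k, AEMeasurable (fun s => (p s).x l ((p s).f l k)) μ
  comparator : ∀ l, ∀ v ∈ F, AEMeasurable (fun s => (p s).x l v) μ

end Random

end OptimisticMD

end

namespace OptimisticMD

open Filter Topology

/-! ### Optimistic mirror descent along a fixed sequence of draws. -/

section MirrorDescent

variable {B : Type*} [NormedAddCommGroup B] [NormedSpace ℝ B]

/-! The first bound holds along every sequence of draws. In `optimistic_round` the optimality of
`f_t` and of `g_{t+1}` are added: the Bregman terms towards the comparator telescope, and the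
leftover `η ⟨f_t - g_{t+1}, x_t - M_t⟩` is absorbed, up to `η² ‖x_t - M_t‖² / 2`, by the quadratic
growth that strong convexity gives. `IsRun.regret_le` sums this, and expectations are then taken.

The second bound is a regret bound for SCRiBLe whose losses are the numbers `‖x_t - M_t^π‖² ≤ 4`.
Because `q_t` is affine in `u_t`, the linearized regret of the estimates has, up to the factor `n /
(n + 1)`, the true regret as conditional mean (`expectDraw_regret`). Along every path the estimates
obey a follow-the-regularized-leader bound (`leader_regret`), whose price per round is quadratic in
the observed loss (`barrier_step`). A loss in `[0, 4]` satisfies `loss² ≤ 4 loss`, so with the given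
step the price is at most a quarter of the learner's own loss and moves to the left side. This
explains a bound on one half of the learner's loss by the loss of the best model plus a term
logarithmic in `T`, instead of a `√T` regret. The comparator is moved slightly inside the simplex,
where the barrier is finite (`exists_near_vertex`). -/

theorem le_of_hasDerivWithinAt_of_le {φ : ℝ → ℝ} {φ' c : ℝ}
    (h : HasDerivWithinAt φ φ' (Set.Ici 0) 0)
    (hle : ∀ s, 0 < s → s ≤ 1 → φ s ≤ φ 0 + s * c) : φ' ≤ c := by
  have h1 := (hasDerivWithinAt_iff_tendsto_slope' (by simp)).1 h.Ioi_of_Ici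
  refine le_of_tendsto h1 ?_
  filter_upwards [Ioc_mem_nhdsGT (zero_lt_one' ℝ)] with s hs
  rw [slope_def_field, sub_zero, div_le_iff₀ hs.1]
  have := hle s hs.1 hs.2
  linarith

theorem le_of_hasDerivWithinAt_of_ge {φ : ℝ → ℝ} {φ' c : ℝ}
    (h : HasDerivWithinAt φ φ' (Set.Ici 0) 0)
    (hle : ∀ s, 0 < s → s ≤ 1 → φ 0 + s * c ≤ φ s) : c ≤ φ' := by
  have := le_of_hasDerivWithinAt_of_le (c := -c) h.neg fun s h0 h1 => by
    have := hle s h0 h1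
    simp only [Pi.neg_apply]
    linarith
  linarith

theorem HasGradientRel.exists_bregman {R : B → ℝ} {F : Set B} {g : B}
    (h : HasGradientRel R F g) :
    ∃ p : StrongDual ℝ B,
      (∀ f ∈ F, HasDerivWithinAt (fun s : ℝ => R (g + s • (f - g))) (p (f - g)) (Set.Ici 0) 0) ∧
      ∀ f ∈ F, bregman R f g = R f - R g - p (f - g) := by
  obtain ⟨p, hp⟩ := h
  refine ⟨p, hp, fun f hf => ?_⟩
  rw [bregman, dirDeriv, (hp f hf).derivWithin (uniqueDiffWithinAt_Ici _)]

theorem segment_mem {F : Set B} (hF : Convex ℝ F) {g f : B} (hg : g ∈ F) (hf : f ∈ F) {s : ℝ}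
    (h0 : 0 < s) (h1 : s ≤ 1) : g + s • (f - g) ∈ F :=
  hF.add_smul_sub_mem hg hf ⟨h0.le, h1⟩

theorem bregman_nonneg {R : B → ℝ} {F : Set B} {g f : B} (hR : ConvexOn ℝ F R)
    (hgrad : HasGradientRel R F g) (hg : g ∈ F) (hf : f ∈ F) : 0 ≤ bregman R f g := by
  obtain ⟨p, hp, hb⟩ := hgrad.exists_bregman
  have := le_of_hasDerivWithinAt_of_le (c := R f - R g) (hp f hf) fun s h0 h1 => by
    have h := hR.2 hg hf (sub_nonneg.2 h1) h0.le (by ring)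
    have e : (1 - s) • g + s • f = g + s • (f - g) := by module
    rw [e] at h
    simp only [smul_eq_mul] at h
    simp only [zero_smul, add_zero]
    linarith
  rw [hb f hf]
  linarith

theorem bregman_le_sub_of_isMinOn {R : B → ℝ} {F : Set B} {g f : B} (hF : Convex ℝ F)
    (hgrad : HasGradientRel R F g) (hg : g ∈ F) (hmin : IsMinOn R F g) (hf : f ∈ F) :
    bregman R f g ≤ R f - R g := by
  obtain ⟨p, hp, hb⟩ := hgrad.exists_bregman
  have := le_of_hasDerivWithinAt_of_ge (c := 0) (hp f hf) fun s h0 h1 => by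
    have := isMinOn_iff.1 hmin _ (segment_mem hF hg hf h0 h1)
    simpa using this
  rw [hb f hf]
  linarith

/-- Compare `a` with `(1 - t) a + t v`, divide the strong convexity inequality by `t`, and let `t →
0`. No derivative of `R` at `a` is involved, so `f_t` needs no gradient of `R`. -/
theorem isMinOn_quadratic_growth {R : B → ℝ} {F : Set B} {a v : B} (hR : StrongConvexOn F 1 R)
    (q : StrongDual ℝ B) (ha : a ∈ F) (hmin : IsMinOn (fun v => q v + R v) F a) (hv : v ∈ F) :
    q a + R a + 1 / 2 * ‖v - a‖ ^ 2 ≤ q v + R v := by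
  have key : ∀ᶠ t in 𝓝[>] (0 : ℝ), q a + R a + (1 - t) * (1 / 2 * ‖v - a‖ ^ 2) ≤ q v + R v := by
    filter_upwards [Ioc_mem_nhdsGT (zero_lt_one' ℝ)] with t ht
    have h := hR.2 ha hv (sub_nonneg.2 ht.2) ht.1.le (by ring)
    have hm := isMinOn_iff.1 hmin _ (hR.1 ha hv (sub_nonneg.2 ht.2) ht.1.le (by ring))
    simp only [smul_eq_mul, map_add, map_smul] at h hm
    rw [norm_sub_rev] at h
    refine le_of_mul_le_mul_left ?_ ht.1
    linarith
  have lim : Tendsto (fun t : ℝ => q a + R a + (1 - t) * (1 / 2 * ‖v - a‖ ^ 2)) (𝓝[>] 0)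
      (𝓝 (q a + R a + (1 - 0) * (1 / 2 * ‖v - a‖ ^ 2))) :=
    (Continuous.tendsto (by fun_prop) 0).mono_left nhdsWithin_le_nhds
  simpa using le_of_tendsto lim key

theorem IsMirrorStep.quadratic_growth {R : B → ℝ} {F : Set B} {η : ℝ} {y : StrongDual ℝ B}
    {c a v : B} (hR : StrongConvexOn F 1 R) (hgrad : HasGradientRel R F c)
    (h : IsMirrorStep F R η y c a) (hv : v ∈ F) :
    η * y a + bregman R a c + 1 / 2 * ‖v - a‖ ^ 2 ≤ η * y v + bregman R v c := by
  obtain ⟨p, -, hb⟩ := hgrad.exists_bregman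
  obtain ⟨ha, hmin⟩ := h
  have hmin' : IsMinOn (fun v => (η • y - p) v + R v) F a := isMinOn_iff.2 fun w hw => by
    have := isMinOn_iff.1 hmin w hw
    rw [hb a ha, hb w hw] at this
    simp only [map_sub] at this
    simp only [sub_apply, smul_apply, smul_eq_mul]
    linarith
  have := isMinOn_quadratic_growth hR _ ha hmin' hv
  rw [hb a ha, hb v hv]
  simp only [sub_apply, smul_apply, smul_eq_mul] at this
  simp only [map_sub]
  linarith

/-- First-order optimality of `a` towards `v`, written with the gradient of `R` at `a`; the linear
terms of the three divergences then combine. -/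
theorem IsMirrorStep.three_point {R : B → ℝ} {F : Set B} {η : ℝ} {y : StrongDual ℝ B}
    {c a v : B} (hF : Convex ℝ F) (hgrad : HasGradientRel R F c) (hgrad' : HasGradientRel R F a)
    (h : IsMirrorStep F R η y c a) (hv : v ∈ F) :
    η * y a + bregman R a c + bregman R v a ≤ η * y v + bregman R v c := by
  obtain ⟨p, -, hb⟩ := hgrad.exists_bregman
  obtain ⟨p', hp', hb'⟩ := hgrad'.exists_bregman
  obtain ⟨ha, hmin⟩ := h
  have := le_of_hasDerivWithinAt_of_ge (c := -(η * y (v - a) - p (v - a))) (hp' v hv)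
    fun s h0 h1 => by
      have hm := segment_mem hF ha hv h0 h1
      have := isMinOn_iff.1 hmin _ hm
      rw [hb a ha, hb _ hm] at this
      simp only [map_sub, map_add, map_smul, smul_eq_mul] at this
      simp only [map_sub, zero_smul, add_zero]
      linarith
  rw [hb a ha, hb v hv, hb' v hv]
  simp only [map_sub] at this ⊢
  linarith

/-- One round of optimistic mirror descent. -/
theorem optimistic_round {R : B → ℝ} {F : Set B} {η : ℝ} {x m : StrongDual ℝ B}
    {g f g' v : B} (hη : 0 < η) (hF : Convex ℝ F) (hR : StrongConvexOn F 1 R) (hg : g ∈ F)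
    (hgrad : HasGradientRel R F g) (hgrad' : HasGradientRel R F g')
    (hf : IsMirrorStep F R η m g f) (hg' : IsMirrorStep F R η x g g') (hv : v ∈ F) :
    x f - x v ≤ η⁻¹ * (bregman R v g - bregman R v g') + η / 2 * ‖x - m‖ ^ 2 := by
  -- The optimality of `f` is tested against `g'`, that of `g'` against `v`. In the sum `bregman R
  -- g' g` cancels.
  have h1 := hf.quadratic_growth hR hgrad hg'.1
  have h2 := hg'.three_point hF hgrad hgrad' hv
  have h3 := bregman_nonneg (hR.convexOn (by intro r; positivity)) hgrad hg hf.1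
  have h4 : (x - m) (f - g') ≤ ‖x - m‖ * ‖f - g'‖ :=
    (le_abs_self _).trans ((x - m).le_opNorm _)
  rw [norm_sub_rev] at h1
  have h5 := mul_le_mul_of_nonneg_left h4 hη.le
  simp only [sub_apply, map_sub] at h5
  refine le_of_mul_le_mul_left ?_ hη
  rw [mul_add, mul_inv_cancel_left₀ hη.ne']
  nlinarith [sq_nonneg (η * ‖x - m‖ - ‖f - g'‖)]

namespace Play

variable {n : ℕ} {p : Play B n} {F : Set B} {R : B → ℝ} {η : ℝ}

theorem IsRun.g_mem (h : p.IsRun F R η) : ∀ l, p.g l ∈ F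
  | [] => h.g_init.1
  | a :: l => (h.g_step l a).1

theorem IsRun.regret_le_bregman (h : p.IsRun F R η) (hη : 0 < η) (hF : Convex ℝ F)
    (hR : StrongConvexOn F 1 R) {v : B} (hv : v ∈ F) (l : History n) :
    pathSum (fun l k => p.x l (p.f l k)) l - pathSum (fun l _ => p.x l v) l ≤
      η⁻¹ * (bregman R v (p.g []) - bregman R v (p.g l))
        + η / 2 * pathSum (fun l k => ‖p.x l - p.M l k‖ ^ 2) l := by
  induction l with
  | nil => simp [pathSum]
  | cons a l ih =>
    have := optimistic_round hη hF hR (h.g_mem l) (h.g_grad l) (h.g_grad (a :: l))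
      (h.f_step l a.model) (h.g_step l a) hv
    simp only [pathSum]
    linarith

theorem IsRun.regret_le (h : p.IsRun F R η) (hη : 0 < η) (hF : Convex ℝ F)
    (hR : StrongConvexOn F 1 R) (hRmax : BddAbove (R '' F)) {v : B} (hv : v ∈ F)
    (l : History n) :
    pathSum (fun l k => p.x l (p.f l k)) l - pathSum (fun l _ => p.x l v) l ≤
      η⁻¹ * RmaxSq F R + η / 2 * pathSum (fun l k => ‖p.x l - p.M l k‖ ^ 2) l := by
  have h1 := h.regret_le_bregman hη hF hR hv l
  have h2 := bregman_nonneg (hR.convexOn (by intro r; positivity)) (h.g_grad l) (h.g_mem l) hv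
  have h3 := bregman_le_sub_of_isMinOn hF (h.g_grad []) (h.g_mem []) h.g_init.2 hv
  have h4 : R v ≤ sSup (R '' F) := le_csSup hRmax ⟨v, hv, rfl⟩
  -- `R` is bounded below on `F` because `g_1` minimizes it there.
  have h5 : sInf (R '' F) ≤ R (p.g []) :=
    csInf_le ⟨R (p.g []), by rintro _ ⟨w, hw, rfl⟩; exact isMinOn_iff.1 h.g_init.2 w hw⟩
      ⟨_, h.g_mem [], rfl⟩
  have h6 : bregman R v (p.g []) - bregman R v (p.g l) ≤ RmaxSq F R := by
    rw [RmaxSq]; linarith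
  have h7 := mul_le_mul_of_nonneg_left h6 (inv_pos.2 hη).le
  linarith

end Play

end MirrorDescent

/-! ### The logarithmic barrier of the simplex. -/

section Barrier

variable {n : ℕ}

/-- The linear part of the `k`-th coordinate of `completeWeights`. -/
noncomputable def weightDir (n : ℕ) (k : Fin (n + 1)) : StrongDual ℝ (EuclideanSpace ℝ (Fin n)) :=
  Fin.snoc (α := fun _ => StrongDual ℝ (EuclideanSpace ℝ (Fin n)))
    (fun i => EuclideanSpace.proj i) (-∑ i, EuclideanSpace.proj i) k

@[simp] theorem weightDir_castSucc (i : Fin n) (v : EuclideanSpace ℝ (Fin n)) :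
    weightDir n i.castSucc v = v i := by
  simp [weightDir]

@[simp] theorem weightDir_last (v : EuclideanSpace ℝ (Fin n)) :
    weightDir n (Fin.last n) v = -∑ i, v i := by
  simp [weightDir]

@[simp] theorem completeWeights_castSucc (i : Fin n) (v : EuclideanSpace ℝ (Fin n)) :
    completeWeights v i.castSucc = v i := by
  simp [completeWeights]

@[simp] theorem completeWeights_last (v : EuclideanSpace ℝ (Fin n)) :
    completeWeights v (Fin.last n) = 1 - ∑ i, v i := by
  simp [completeWeights]

theorem completeWeights_eq (k : Fin (n + 1)) (v : EuclideanSpace ℝ (Fin n)) :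
    completeWeights v k = completeWeights 0 k + weightDir n k v := by
  refine Fin.lastCases ?_ (fun i => ?_) k
  · simp [sub_eq_add_neg]
  · simp

theorem weightDir_sub (k : Fin (n + 1)) (u v : EuclideanSpace ℝ (Fin n)) :
    weightDir n k (u - v) = completeWeights u k - completeWeights v k := by
  rw [completeWeights_eq k u, completeWeights_eq k v, map_sub]
  ring

theorem completeWeights_add (k : Fin (n + 1)) (u v : EuclideanSpace ℝ (Fin n)) :
    completeWeights (u + v) k = completeWeights u k + weightDir n k v := by
  rw [completeWeights_eq k u, completeWeights_eq k (u + v), map_add]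
  ring

theorem sum_completeWeights (v : EuclideanSpace ℝ (Fin n)) : ∑ k, completeWeights v k = 1 := by
  simp [Fin.sum_univ_castSucc]

theorem exists_completeWeights (a : Fin (n + 1) → ℝ) (ha : ∑ k, a k = 1) :
    ∃ v : EuclideanSpace ℝ (Fin n), ∀ k, completeWeights v k = a k := by
  refine ⟨WithLp.toLp 2 fun i => a i.castSucc, fun k => ?_⟩
  rw [Fin.sum_univ_castSucc] at ha
  refine Fin.lastCases ?_ (fun i => ?_) k
  · simp only [completeWeights_last]
    linarith
  · simp

theorem mem_openSimplex_iff {v : EuclideanSpace ℝ (Fin n)} :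
    v ∈ openSimplex n ↔ ∀ k, 0 < completeWeights v k := by
  rw [Fin.forall_fin_succ']
  simp [openSimplex]

/-- In all `n + 1` weights the barrier is symmetric, a sum of logarithms of affine functions, so its
Hessian is a weighted sum of squares of the functionals `weightDir n k`. -/
theorem barrier_eq (v : EuclideanSpace ℝ (Fin n)) :
    barrier n v = -∑ k, Real.log (completeWeights v k) := by
  simp only [barrier, Fin.sum_univ_castSucc, completeWeights_castSucc, completeWeights_last]
  ring

theorem hasFDerivAt_completeWeights (k : Fin (n + 1)) (v : EuclideanSpace ℝ (Fin n)) :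
    HasFDerivAt (fun v => completeWeights v k) (weightDir n k) v := by
  have : (fun v : EuclideanSpace ℝ (Fin n) => completeWeights v k) =
      fun v => completeWeights 0 k + weightDir n k v := funext fun v => completeWeights_eq k v
  rw [this]
  exact (weightDir n k).hasFDerivAt.const_add _

theorem isOpen_openSimplex : IsOpen (openSimplex n) := by
  have : openSimplex n = ⋂ k, {v | 0 < completeWeights v k} := by
    ext v
    simp [mem_openSimplex_iff]
  rw [this]
  refine isOpen_iInter_of_finite fun k => isOpen_lt continuous_const ?_
  exact continuous_iff_continuousAt.2 fun v => (hasFDerivAt_completeWeights k v).continuousAt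

theorem hasFDerivAt_barrier {v : EuclideanSpace ℝ (Fin n)} (hv : v ∈ openSimplex n) :
    HasFDerivAt (barrier n) (-∑ k, (completeWeights v k)⁻¹ • weightDir n k) v := by
  rw [mem_openSimplex_iff] at hv
  have h : HasFDerivAt (fun v => -∑ k, Real.log (completeWeights v k))
      (-∑ k, (completeWeights v k)⁻¹ • weightDir n k) v :=
    (HasFDerivAt.fun_sum fun k _ => (hasFDerivAt_completeWeights k v).log (hv k).ne').fun_neg
  exact h.congr_of_eventuallyEq (Eventually.of_forall barrier_eq)

theorem hessian_barrier_apply {v : EuclideanSpace ℝ (Fin n)} (hv : v ∈ openSimplex n)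
    (y z : EuclideanSpace ℝ (Fin n)) :
    fderiv ℝ (fderiv ℝ (barrier n)) v y z =
      ∑ k, weightDir n k y * weightDir n k z / completeWeights v k ^ 2 := by
  have h : HasFDerivAt (fun v => -∑ k, (completeWeights v k)⁻¹ • weightDir n k)
      (-∑ k, (-(completeWeights v k ^ 2)⁻¹ • weightDir n k).smulRight (weightDir n k)) v := by
    rw [mem_openSimplex_iff] at hv
    refine (HasFDerivAt.fun_sum fun k _ => ?_).fun_neg
    exact ((hasDerivAt_inv (hv k).ne').comp_hasFDerivAt v
      (hasFDerivAt_completeWeights k v)).smul_const (weightDir n k)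
  have h' := h.congr_of_eventuallyEq (f₁ := fderiv ℝ (barrier n)) (by
    filter_upwards [isOpen_openSimplex.mem_nhds hv] with w hw
    exact (hasFDerivAt_barrier hw).fderiv)
  rw [h'.fderiv]
  simp only [neg_apply, sum_apply, ContinuousLinearMap.smulRight_apply, smul_apply, smul_eq_mul,
    ← Finset.sum_neg_distrib]
  refine Finset.sum_congr rfl fun k _ => ?_
  ring

section Eigen

variable {v : EuclideanSpace ℝ (Fin n)}
  {b : OrthonormalBasis (Fin n) ℝ (EuclideanSpace ℝ (Fin n))} {lam : Fin n → ℝ}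

theorem IsHessianEigenbasis.mul_inner (h : IsHessianEigenbasis v b lam) (hv : v ∈ openSimplex n)
    (i : Fin n) (z : EuclideanSpace ℝ (Fin n)) :
    lam i * inner ℝ (b i) z =
      ∑ k, weightDir n k (b i) * weightDir n k z / completeWeights v k ^ 2 := by
  rw [← hessian_barrier_apply hv, h i]
  simp

theorem IsHessianEigenbasis.eq_sum (h : IsHessianEigenbasis v b lam) (hv : v ∈ openSimplex n)
    (i : Fin n) : lam i = ∑ k, (weightDir n k (b i) / completeWeights v k) ^ 2 := by
  have := h.mul_inner hv i (b i)
  rw [real_inner_self_eq_norm_sq, b.norm_eq_one, one_pow, mul_one] at this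
  rw [this]
  refine Finset.sum_congr rfl fun k _ => ?_
  rw [div_pow, sq, sq]

theorem IsHessianEigenbasis.pos (h : IsHessianEigenbasis v b lam) (hv : v ∈ openSimplex n)
    (i : Fin n) : 0 < lam i := by
  have hne : b i ≠ 0 := b.toBasis.ne_zero i |> fun h => by simpa using h
  obtain ⟨j, hj⟩ : ∃ j, b i j ≠ 0 := by
    by_contra! hcon
    exact hne (PiLp.ext hcon)
  rw [h.eq_sum hv]
  refine Finset.sum_pos' (fun k _ => sq_nonneg _) ⟨j.castSucc, Finset.mem_univ _, ?_⟩
  have := (mem_openSimplex_iff.1 hv j.castSucc).ne'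
  have : weightDir n j.castSucc (b i) ≠ 0 := by simpa using hj
  positivity

/-- The Dikin ellipsoid lies in the closed simplex. -/
theorem IsHessianEigenbasis.completeWeights_nonneg (h : IsHessianEigenbasis v b lam)
    (hv : v ∈ openSimplex n) (i : Fin n) (s : ℤˣ) (k : Fin (n + 1)) :
    0 ≤ completeWeights (v + (((s : ℤ) : ℝ) * (Real.sqrt (lam i))⁻¹) • b i) k := by
  have hk := mem_openSimplex_iff.1 hv k
  have hl := Real.sqrt_pos.2 (h.pos hv i)
  have h1 : (weightDir n k (b i) / completeWeights v k) ^ 2 ≤ lam i := by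
    rw [h.eq_sum hv i]
    exact Finset.single_le_sum
      (f := fun k => (weightDir n k (b i) / completeWeights v k) ^ 2)
      (fun k _ => sq_nonneg _) (Finset.mem_univ k)
  have h2 := Real.abs_le_sqrt h1
  rw [abs_div, abs_of_pos hk, div_le_iff₀ hk] at h2
  have h3 : |((s : ℤ) : ℝ) * (Real.sqrt (lam i))⁻¹ * weightDir n k (b i)| ≤
      completeWeights v k := by
    rw [abs_mul, abs_mul, abs_of_pos (inv_pos.2 hl)]
    have : |((s : ℤ) : ℝ)| = 1 := by
      rcases Int.units_eq_one_or s with rfl | rfl <;> simp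
    rw [this, one_mul, inv_mul_le_iff₀ hl]
    exact h2
  rw [completeWeights_add, map_smul, smul_eq_mul]
  linarith [neg_le_of_abs_le h3]

end Eigen

theorem sub_two_mul_sq_le_log_one_add {b : ℝ} (hb : |b| ≤ 1 / 2) :
    b - 2 * b ^ 2 ≤ Real.log (1 + b) := by
  have h1 := neg_le_of_abs_le hb
  have hp : 0 < 1 + b := by linarith
  have h := Real.one_sub_inv_le_log_of_pos hp
  refine le_trans ?_ h
  rw [← sub_nonneg]
  have : 1 - (1 + b)⁻¹ - (b - 2 * b ^ 2) = b ^ 2 * (1 + 2 * b) * (1 + b)⁻¹ := by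
    field_simp
    ring
  rw [this]
  have : 0 ≤ 1 + 2 * b := by linarith
  positivity

/-- Apply `log y ≤ y - 1` to `y = r (1 + b)`; what remains is `log (1 + b) - b`, which is at least
`-2 b²`. -/
theorem neg_two_mul_sq_le {r b : ℝ} (hr : 0 < r) (hb : |b| ≤ 1 / 2) :
    -(2 * b ^ 2) ≤ r - 1 - Real.log r + b * (r - 1) := by
  have hb' : 0 < 1 + b := by linarith [neg_le_of_abs_le hb]
  have h1 := Real.log_le_sub_one_of_pos (mul_pos hr hb')
  rw [Real.log_mul hr.ne' hb'.ne'] at h1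
  have h2 := sub_two_mul_sq_le_log_one_add hb
  linarith

/-- One step of follow the regularized leader with the barrier of the simplex: adding a linear
loss along an eigenvector does not decrease the minimum by much. -/
theorem barrier_step {L h v : EuclideanSpace ℝ (Fin n)}
    {b : OrthonormalBasis (Fin n) ℝ (EuclideanSpace ℝ (Fin n))} {lam : Fin n → ℝ} {a : ℝ}
    (hh : h ∈ openSimplex n) (hv : v ∈ openSimplex n)
    (hmin : IsMinOn (fun w => inner ℝ w L + barrier n w) (openSimplex n) h)
    (he : IsHessianEigenbasis h b lam) (i : Fin n) (ha : |a| ≤ 1 / 2) :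
    inner ℝ h L + barrier n h - 2 * a ^ 2 ≤
      inner ℝ v L + barrier n v + a * (Real.sqrt (lam i) * inner ℝ (v - h) (b i)) := by
  have hh' := mem_openSimplex_iff.1 hh
  have hv' := mem_openSimplex_iff.1 hv
  have hpos := he.pos hh i
  have hl := Real.sqrt_pos.2 hpos
  -- The minimizer `h` is interior, so the gradient vanishes. Everything can then be written in the
  -- ratios of the weights of `v` to those of `h`, and the claim splits into one scalar inequality
  -- per weight.
  have hcrit : inner ℝ (v - h) L = ∑ k, (completeWeights v k / completeWeights h k - 1) := by
    have hd : HasFDerivAt (fun w => inner ℝ w L + barrier n w)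
        (innerSL ℝ L + -∑ k, (completeWeights h k)⁻¹ • weightDir n k) h := by
      refine HasFDerivAt.add ?_ (hasFDerivAt_barrier hh)
      refine (innerSL ℝ L).hasFDerivAt.congr_of_eventuallyEq (Eventually.of_forall fun w => ?_)
      simp [real_inner_comm]
    have := (hmin.isLocalMin (isOpen_openSimplex.mem_nhds hh)).hasFDerivAt_eq_zero hd
    have := congrArg (fun A => A (v - h)) this
    simp only [add_apply, neg_apply, sum_apply, smul_apply, innerSL_apply_apply, weightDir_sub,
      smul_eq_mul, zero_apply] at this
    rw [real_inner_comm, eq_neg_of_add_eq_zero_left this, neg_neg]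
    refine Finset.sum_congr rfl fun k _ => ?_
    have := (hh' k).ne'
    field_simp
  have hbar : barrier n v - barrier n h =
      -∑ k, Real.log (completeWeights v k / completeWeights h k) := by
    rw [barrier_eq, barrier_eq, ← Finset.sum_neg_distrib, ← Finset.sum_neg_distrib,
      ← Finset.sum_sub_distrib, ← Finset.sum_neg_distrib]
    refine Finset.sum_congr rfl fun k _ => ?_
    rw [Real.log_div (hv' k).ne' (hh' k).ne']
    ring
  -- The eigenvector rescaled to unit length in the local norm at `h`; hence `∑ w k ^ 2 = 1` and the
  -- scalar errors add up to `2 a²`.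
  set w : Fin (n + 1) → ℝ := fun k =>
    (Real.sqrt (lam i))⁻¹ * (weightDir n k (b i) / completeWeights h k) with hw
  have hwsq : ∑ k, w k ^ 2 = 1 := by
    simp only [hw, mul_pow, ← Finset.mul_sum]
    rw [← he.eq_sum hh i, inv_pow, Real.sq_sqrt hpos.le, inv_mul_cancel₀ hpos.ne']
  have hwle : ∀ k, |w k| ≤ 1 := fun k => by
    rw [← sq_le_one_iff_abs_le_one, ← hwsq]
    exact Finset.single_le_sum (f := fun k => w k ^ 2) (fun k _ => sq_nonneg _)
      (Finset.mem_univ k)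
  have hlin : Real.sqrt (lam i) * inner ℝ (v - h) (b i) =
      ∑ k, w k * (completeWeights v k / completeWeights h k - 1) := by
    have h1 := he.mul_inner hh i (v - h)
    rw [real_inner_comm, eq_div_of_mul_eq hpos.ne' ((mul_comm _ _).trans h1), mul_div_assoc',
      mul_comm, mul_div_assoc, Real.sqrt_div_self', Finset.sum_mul]
    refine Finset.sum_congr rfl fun k _ => ?_
    have := (hh' k).ne'
    rw [weightDir_sub]
    simp only [hw]
    field_simp
  have hsum : -(2 * a ^ 2) ≤ ∑ k, (completeWeights v k / completeWeights h k - 1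
      - Real.log (completeWeights v k / completeWeights h k)
      + a * w k * (completeWeights v k / completeWeights h k - 1)) := by
    calc -(2 * a ^ 2) = ∑ k, -(2 * (a * w k) ^ 2) := by
          simp only [mul_pow, Finset.sum_neg_distrib, ← Finset.mul_sum, hwsq, mul_one]
      _ ≤ _ := Finset.sum_le_sum fun k _ => neg_two_mul_sq_le (div_pos (hv' k) (hh' k)) (by
          rw [abs_mul]
          exact (mul_le_of_le_one_right (abs_nonneg _) (hwle k)).trans ha)
  simp only [Finset.sum_add_distrib, Finset.sum_sub_distrib (f := fun k =>
    completeWeights v k / completeWeights h k - 1), mul_assoc, ← Finset.mul_sum, ← hlin,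
    ← hcrit] at hsum
  rw [inner_sub_left] at hsum
  linarith

theorem le_barrier {v : EuclideanSpace ℝ (Fin n)} (hv : v ∈ openSimplex n) :
    ((n : ℝ) + 1) * Real.log ((n : ℝ) + 1) ≤ barrier n v := by
  rw [mem_openSimplex_iff] at hv
  have hn : (0 : ℝ) < n + 1 := by positivity
  have h := Finset.sum_le_sum fun k (_ : k ∈ Finset.univ) =>
    Real.log_le_sub_one_of_pos (mul_pos hn (hv k))
  simp only [Real.log_mul hn.ne' (hv _).ne', Finset.sum_add_distrib, Finset.sum_sub_distrib,
    ← Finset.mul_sum, sum_completeWeights] at h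
  simp only [Finset.sum_const, Finset.card_univ, Fintype.card_fin, nsmul_eq_mul] at h
  push_cast at h
  rw [barrier_eq]
  linarith

/-- A point of the open simplex near a given vertex. -/
theorem exists_near_vertex (j : Fin (n + 1)) {δ : ℝ} (h0 : 0 < δ) (h1 : δ ≤ 1) :
    ∃ u ∈ openSimplex n,
      barrier n u ≤ ((n : ℝ) + 1) * Real.log ((n : ℝ) + 1) + n * Real.log δ⁻¹ ∧
      ∀ (c : Fin (n + 1) → ℝ) (C : ℝ), (∀ k, 0 ≤ c k) → (∀ k, c k ≤ C) →
        ∑ k, completeWeights u k * c k ≤ c j + δ * C := by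
  have hn : (0 : ℝ) < n + 1 := by positivity
  -- The mixture of the vertex `j`, with weight `1 - δ`, and the uniform distribution, with weight
  -- `δ`.
  obtain ⟨u, hu⟩ := exists_completeWeights
    (fun k => (if k = j then 1 - δ else 0) + δ / ((n : ℝ) + 1)) (by
      simp only [Finset.sum_add_distrib, Finset.sum_ite_eq', Finset.mem_univ, if_true,
        Finset.sum_const, Finset.card_univ, Fintype.card_fin, nsmul_eq_mul]
      push_cast
      field_simp
      ring)
  have hge : ∀ k, δ / ((n : ℝ) + 1) ≤ completeWeights u k := fun k => by
    rw [hu]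
    split_ifs <;> linarith
  have hpos : ∀ k, 0 < completeWeights u k := fun k => (div_pos h0 hn).trans_le (hge k)
  refine ⟨u, mem_openSimplex_iff.2 hpos, ?_, fun c C hc hC => ?_⟩
  · have hle : ∀ k, -Real.log (completeWeights u k) ≤
        Real.log ((n : ℝ) + 1) + if k = j then 0 else Real.log δ⁻¹ := fun k => by
      by_cases hk : k = j
      · have : ((n : ℝ) + 1)⁻¹ ≤ completeWeights u k := by
          rw [hu, if_pos hk, inv_eq_one_div, ← sub_nonneg]
          have : 1 - δ + δ / ((n : ℝ) + 1) - 1 / (n + 1) = (1 - δ) * (n / (n + 1)) := by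
            field_simp
            ring
          rw [this]
          have := sub_nonneg.2 h1
          positivity
        have := Real.log_le_log (by positivity) this
        rw [Real.log_inv] at this
        rw [if_pos hk]
        linarith
      · have := Real.log_le_log (by positivity) (hge k)
        rw [Real.log_div h0.ne' hn.ne'] at this
        rw [if_neg hk, Real.log_inv]
        linarith
    rw [barrier_eq, ← Finset.sum_neg_distrib]
    refine (Finset.sum_le_sum fun k _ => hle k).trans_eq ?_
    rw [Finset.sum_add_distrib, Finset.sum_ite, Finset.filter_ne']
    simp
  · calc ∑ k, completeWeights u k * c k
        = (1 - δ) * c j + δ / ((n : ℝ) + 1) * ∑ k, c k := by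
          simp only [hu, add_mul, Finset.sum_add_distrib, ite_mul, zero_mul, Finset.sum_ite_eq',
            Finset.mem_univ, if_true, Finset.mul_sum]
      _ ≤ (1 - δ) * c j + δ / ((n : ℝ) + 1) * ∑ _k : Fin (n + 1), C := by
          gcongr with k
          exact hC k
      _ = (1 - δ) * c j + δ * C := by
          simp only [Finset.sum_const, Finset.card_univ, Fintype.card_fin, nsmul_eq_mul]
          push_cast
          field_simp
      _ ≤ c j + δ * C := by nlinarith [hc j]

end Barrier

/-! ### Expectation over the learner's draws, and the bandit regret. -/

/-- The sum over the rounds of a history of a cost that depends on the round's own past and on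
all the draws of that round. -/
def drawSum {n : ℕ} (c : History n → Draw n → ℝ) : History n → ℝ
  | [] => 0
  | a :: l => drawSum c l + c l a

namespace Play

variable {B : Type*} [NormedAddCommGroup B] [NormedSpace ℝ B] {n : ℕ} {p : Play B n}

/-- Conditional expectation, given the history, over the draws of one round. -/
noncomputable def expectDraw (p : Play B n) (l : History n) (φ : Draw n → ℝ) : ℝ :=
  ∑ i : Fin n, ∑ s : ℤˣ, ∑ k : Fin (n + 1), p.prob l ⟨i, s, k⟩ * φ ⟨i, s, k⟩

theorem expectFrom_succ (T : ℕ) (l : History n) (Φ : History n → ℝ) :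
    p.expectFrom (T + 1) l Φ = p.expectDraw l fun a => p.expectFrom T (a :: l) Φ := rfl

theorem expectDraw_add (l : History n) (φ ψ : Draw n → ℝ) :
    p.expectDraw l (fun a => φ a + ψ a) = p.expectDraw l φ + p.expectDraw l ψ := by
  simp only [expectDraw, mul_add, Finset.sum_add_distrib]

theorem expectDraw_const_mul (l : History n) (r : ℝ) (φ : Draw n → ℝ) :
    p.expectDraw l (fun a => r * φ a) = r * p.expectDraw l φ := by
  simp only [expectDraw, mul_left_comm _ r, Finset.mul_sum]

theorem expectDraw_mono (hp : ∀ l a, 0 ≤ p.prob l a) (l : History n) {φ ψ : Draw n → ℝ}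
    (h : ∀ a, φ a ≤ ψ a) : p.expectDraw l φ ≤ p.expectDraw l ψ :=
  Finset.sum_le_sum fun _ _ => Finset.sum_le_sum fun _ _ => Finset.sum_le_sum fun _ _ =>
    mul_le_mul_of_nonneg_left (h _) (hp _ _)

theorem expectFrom_add (T : ℕ) (l : History n) (Φ Ψ : History n → ℝ) :
    p.expectFrom T l (fun l => Φ l + Ψ l) = p.expectFrom T l Φ + p.expectFrom T l Ψ := by
  induction T generalizing l with
  | zero => rfl
  | succ T ih => simp only [expectFrom_succ, ih, expectDraw_add]

theorem expectFrom_const_mul (T : ℕ) (l : History n) (r : ℝ) (Φ : History n → ℝ) :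
    p.expectFrom T l (fun l => r * Φ l) = r * p.expectFrom T l Φ := by
  induction T generalizing l with
  | zero => rfl
  | succ T ih => simp only [expectFrom_succ, ih, expectDraw_const_mul]

theorem expectFrom_const (hp : ∀ l, p.expectDraw l (fun _ => 1) = 1) (T : ℕ) (l : History n)
    (r : ℝ) : p.expectFrom T l (fun _ => r) = r := by
  induction T generalizing l with
  | zero => rfl
  | succ T ih =>
    have := p.expectDraw_const_mul l r fun _ => 1
    simp only [mul_one, hp] at this
    simp only [expectFrom_succ, ih, this]

theorem expectFrom_mono (hp : ∀ l a, 0 ≤ p.prob l a) {T : ℕ} {l : History n}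
    {Φ Ψ : History n → ℝ} (h : ∀ l', l'.length = l.length + T → Φ l' ≤ Ψ l') :
    p.expectFrom T l Φ ≤ p.expectFrom T l Ψ := by
  induction T generalizing l with
  | zero =>
    simp only [expectFrom]
    exact h l (by simp)
  | succ T ih =>
    rw [expectFrom_succ, expectFrom_succ]
    refine expectDraw_mono hp l fun a => ih fun l' hl' => h l' ?_
    rw [hl', List.length_cons]
    omega

/-- The partial sums form a supermartingale. -/
theorem expectFrom_drawSum_le (hp : ∀ l a, 0 ≤ p.prob l a)
    (hp1 : ∀ l, p.expectDraw l (fun _ => 1) = 1) {w : History n → Draw n → ℝ}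
    (hw : ∀ l, p.expectDraw l (w l) ≤ 0) (T : ℕ) (l : History n) :
    p.expectFrom T l (drawSum w) ≤ drawSum w l := by
  induction T generalizing l with
  | zero => rfl
  | succ T ih =>
    rw [expectFrom_succ]
    refine (expectDraw_mono hp l fun a => ih (a :: l)).trans ?_
    have := p.expectDraw_const_mul l (drawSum w l) fun _ => 1
    simp only [mul_one, hp1] at this
    simp only [drawSum, expectDraw_add, this]
    linarith [hw l]

namespace IsRun

variable {F : Set B} {R : B → ℝ} {η : ℝ}

theorem prob_nonneg (h : p.IsRun F R η) (l : History n) (a : Draw n) : 0 ≤ p.prob l a :=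
  mul_nonneg (by positivity) ((h.eigen l).completeWeights_nonneg (h.h_mem l) a.dir a.sign a.model)

/-- Averaging over the sign keeps only the even terms: the mean of `q_t` is the completion of `h_t`,
and the factors `√λ` and `λ^{-1/2}` cancel in the product of the two odd terms. Averaging over the
index then expands `z` in the eigenbasis. -/
theorem expectDraw_eq (h : p.IsRun F R η) (hn : 1 ≤ n) (l : History n) (α β : Fin (n + 1) → ℝ)
    (z : EuclideanSpace ℝ (Fin n)) :
    p.expectDraw l (fun a => α a.model + β a.model *
        (((a.sign : ℤ) : ℝ) * Real.sqrt (p.lam l a.dir) * inner ℝ (p.e l a.dir) z)) =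
      ∑ k, completeWeights (p.h l) k * α k + 1 / n * ∑ k, β k * weightDir n k z := by
  have hn' : (n : ℝ) ≠ 0 := by positivity
  have hz : ∀ k, weightDir n k z =
      ∑ i, inner ℝ (p.e l i) z * weightDir n k (p.e l i) := fun k => by
    conv_lhs => rw [← (p.e l).sum_repr' z]
    simp
  have hi : ∀ i, (∑ s : ℤˣ, ∑ k, p.prob l ⟨i, s, k⟩ * (α k + β k *
      (((s : ℤ) : ℝ) * Real.sqrt (p.lam l i) * inner ℝ (p.e l i) z))) =
      1 / n * ∑ k, (completeWeights (p.h l) k * α k +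
        β k * (inner ℝ (p.e l i) z * weightDir n k (p.e l i))) := fun i => by
    have hl := (Real.sqrt_pos.2 ((h.eigen l).pos (h.h_mem l) i)).ne'
    rw [Finset.sum_comm, Finset.mul_sum]
    refine Finset.sum_congr rfl fun k _ => ?_
    have : (Finset.univ : Finset ℤˣ) = {1, -1} := rfl
    rw [this, Finset.sum_pair (by decide)]
    simp only [prob, q, completeWeights_add, map_smul, smul_eq_mul, Units.val_one, Int.cast_one,
      Units.val_neg, Int.cast_neg]
    field_simp
    ring
  simp only [expectDraw, hi, ← Finset.mul_sum, Finset.sum_add_distrib, hz]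
  rw [Finset.sum_const, Finset.card_univ, Fintype.card_fin, nsmul_eq_mul, Finset.sum_comm, mul_add,
    ← mul_assoc, one_div_mul_cancel hn', one_mul]
  simp only [Finset.mul_sum]

theorem expectDraw_one (h : p.IsRun F R η) (hn : 1 ≤ n) (l : History n) :
    p.expectDraw l (fun _ => 1) = 1 := by
  have := h.expectDraw_eq hn l (fun _ => 1) (fun _ => 0) 0
  simpa [sum_completeWeights] using this

/-- The estimates are unbiased, up to a factor that does not depend on the round. -/
theorem expectDraw_regret (h : p.IsRun F R η) (hn : 1 ≤ n) (l : History n)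
    (u : EuclideanSpace ℝ (Fin n)) :
    p.expectDraw l (fun a => p.modelLoss l a.model - ∑ k, completeWeights u k * p.modelLoss l k
      - n / ((n : ℝ) + 1) * inner ℝ (p.h l - u) (p.estimate l a)) = 0 := by
  have hn' : (n : ℝ) ≠ 0 := by positivity
  have := h.expectDraw_eq hn l
    (fun k => p.modelLoss l k - ∑ k, completeWeights u k * p.modelLoss l k)
    -- The estimate carries `d = n + 1`, whereas the uniform index among `n` directions calls for
    -- `n`; the factor `n / (n + 1)` corrects this.
    (fun k => -n * p.modelLoss l k) (p.h l - u)
  convert this using 1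
  · congr 1
    funext a
    rw [estimate, real_inner_smul_right, real_inner_comm]
    field_simp
    ring
  · simp only [mul_sub, Finset.sum_sub_distrib, ← Finset.sum_mul, sum_completeWeights,
      weightDir_sub, one_mul, neg_mul, mul_assoc, Finset.sum_neg_distrib, ← Finset.mul_sum]
    field_simp
    simp only [mul_comm (p.modelLoss l _)]
    ring

/-- Follow the regularized leader, along every sequence of draws. -/
theorem leader_regret (h : p.IsRun F R η) (hloss : ∀ l k, p.modelLoss l k ≤ 4)
    {u : EuclideanSpace ℝ (Fin n)} (hu : u ∈ openSimplex n) (l : History n) :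
    drawSum (fun l a => 1 / (32 * ((n : ℝ) + 1) ^ 2) * inner ℝ (p.h l - u) (p.estimate l a)) l
      - drawSum (fun l a => 2 * (p.modelLoss l a.model / (32 * ((n : ℝ) + 1))) ^ 2) l ≤
    barrier n u - barrier n (p.h []) := by
  -- The minimum of the regularized objective is the potential: `barrier_step` bounds its change in
  -- one round from below.
  have key : ∀ l, drawSum (fun l a => 1 / (32 * ((n : ℝ) + 1) ^ 2) *
        inner ℝ (p.h l) (p.estimate l a)) l
      - drawSum (fun l a => 2 * (p.modelLoss l a.model / (32 * ((n : ℝ) + 1))) ^ 2) l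
      + barrier n (p.h []) ≤
      1 / (32 * ((n : ℝ) + 1) ^ 2) * inner ℝ (p.h l) (p.sumEstimates l) + barrier n (p.h l) := by
    intro l
    induction l with
    | nil => simp [drawSum, sumEstimates]
    | cons a l ih =>
      have hm := h.h_minOn l
      simp only [← real_inner_smul_right] at hm
      have hnn : 0 ≤ p.modelLoss l a.model := sq_nonneg _
      have hs : |((a.sign : ℤ) : ℝ)| = 1 := by
        rcases Int.units_eq_one_or a.sign with e | e <;> simp [e]
      -- Here `a` is the step `1 / (32 d²)` times the factor `d · loss · ε` of the estimate; since
      -- the loss is at most `4`, `|a| ≤ 1 / 8`.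
      have := barrier_step (h.h_mem l) (h.h_mem (a :: l)) hm (h.eigen l) a.dir
        (a := ((a.sign : ℤ) : ℝ) * (p.modelLoss l a.model / (32 * ((n : ℝ) + 1)))) (by
          rw [abs_mul, hs, one_mul, abs_of_nonneg (by positivity), div_le_iff₀ (by positivity)]
          have := hloss l a.model
          have : (0 : ℝ) ≤ n := by positivity
          linarith)
      rw [mul_pow, ← sq_abs ((a.sign : ℤ) : ℝ), hs, one_pow, one_mul] at this
      simp only [real_inner_smul_right] at this
      have e : ((a.sign : ℤ) : ℝ) * (p.modelLoss l a.model / (32 * ((n : ℝ) + 1))) *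
          (Real.sqrt (p.lam l a.dir) * inner ℝ (p.h (a :: l) - p.h l) (p.e l a.dir)) =
          1 / (32 * ((n : ℝ) + 1) ^ 2) *
            inner ℝ (p.h (a :: l) - p.h l) (p.estimate l a) := by
        rw [estimate, real_inner_smul_right]
        field_simp
      rw [e, inner_sub_left] at this
      simp only [drawSum, sumEstimates, inner_add_right]
      linarith
  have hsum : ∀ l, drawSum (fun l a => 1 / (32 * ((n : ℝ) + 1) ^ 2) *
        inner ℝ (p.h l - u) (p.estimate l a)) l =
      drawSum (fun l a => 1 / (32 * ((n : ℝ) + 1) ^ 2) * inner ℝ (p.h l) (p.estimate l a)) l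
      - 1 / (32 * ((n : ℝ) + 1) ^ 2) * inner ℝ u (p.sumEstimates l) := by
    intro l
    induction l with
    | nil => simp [drawSum, sumEstimates]
    | cons a l ih =>
      rw [drawSum, ih]
      simp only [drawSum, sumEstimates, inner_add_right, inner_sub_left]
      ring
  have := isMinOn_iff.1 (h.h_minOn l) u hu
  rw [hsum]
  linarith [key l]

/-- SCRiBLe for multi-armed bandits: the regret against a fixed model. -/
theorem bandit_regret (h : p.IsRun F R η) (hn : 1 ≤ n) (hloss : ∀ l k, p.modelLoss l k ≤ 4)
    {T : ℕ} (hT : 1 ≤ T) (j : Fin (n + 1)) :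
    1 / 2 * p.expectFrom T [] (pathSum p.modelLoss) ≤
      p.expectFrom T [] (pathSum fun l _ => p.modelLoss l j)
        + 32 * ((n : ℝ) + 1) ^ 3 * Real.log ((T : ℝ) * ((n : ℝ) + 1)) := by
  have hnn : ∀ l k, 0 ≤ p.modelLoss l k := fun l k => sq_nonneg _
  have hn1 : (1 : ℝ) ≤ n := by exact_mod_cast hn
  have hT1 : (1 : ℝ) ≤ T := by exact_mod_cast hT
  have hTd : 2 ≤ (T : ℝ) * ((n : ℝ) + 1) := by nlinarith
  set L := Real.log ((T : ℝ) * ((n : ℝ) + 1)) with hL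
  have hL2 : 1 / 2 ≤ L := by
    have := Real.log_le_log two_pos hTd
    linarith [Real.log_two_gt_d9]
  -- With this `δ` the move off the vertex costs at most `4 δ T ≤ 2` in total, while the barrier
  -- rises by at most `n L` above its minimum.
  obtain ⟨u, hu, hbar, hnear⟩ := exists_near_vertex (n := n) j
    (δ := ((T : ℝ) * ((n : ℝ) + 1))⁻¹) (by positivity) (inv_le_one_of_one_le₀ (by linarith))
  rw [inv_inv, ← hL] at hbar
  set δ := ((T : ℝ) * ((n : ℝ) + 1))⁻¹ with hδ
  have hbar' : barrier n u - barrier n (p.h []) ≤ n * L := by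
    linarith [le_barrier (h.h_mem [])]
  set w : History n → Draw n → ℝ := fun l a =>
    p.modelLoss l a.model - ∑ k, completeWeights u k * p.modelLoss l k
      - n / ((n : ℝ) + 1) * inner ℝ (p.h l - u) (p.estimate l a) with hw
  have hE := expectFrom_drawSum_le h.prob_nonneg (h.expectDraw_one hn) (w := w)
    (fun l => (h.expectDraw_regret hn l u).le) T []
  -- The factor `32 (n + 1) n` is `n / (n + 1)` divided by the step. The missing quarter of the
  -- learner's loss pays for the quadratic terms (`h4`).
  have hpath : ∀ l : History n, 3 / 4 * pathSum p.modelLoss l -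
      pathSum (fun l _ => p.modelLoss l j) l - 4 * δ * l.length
      - 32 * ((n : ℝ) + 1) * n * (n * L) ≤ drawSum w l := by
    intro l
    have h1 := (h.leader_regret hloss hu l).trans hbar'
    have h2 : ∀ l : History n, 3 / 4 * pathSum p.modelLoss l -
        pathSum (fun l _ => p.modelLoss l j) l - 4 * δ * l.length
        - 32 * ((n : ℝ) + 1) * n * (drawSum (fun l a => 1 / (32 * ((n : ℝ) + 1) ^ 2) *
          inner ℝ (p.h l - u) (p.estimate l a)) l
          - drawSum (fun l a => 2 * (p.modelLoss l a.model / (32 * ((n : ℝ) + 1))) ^ 2) l) ≤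
        drawSum w l := by
      intro l
      induction l with
      | nil => simp [drawSum, pathSum]
      | cons a l ih =>
        have h3 := hnear (p.modelLoss l) 4 (hnn l) (hloss l)
        have h4 : 32 * ((n : ℝ) + 1) * n * (2 * (p.modelLoss l a.model / (32 * ((n : ℝ) + 1))) ^ 2)
            ≤ 1 / 4 * p.modelLoss l a.model := by
          have e : 32 * ((n : ℝ) + 1) * n *
              (2 * (p.modelLoss l a.model / (32 * ((n : ℝ) + 1))) ^ 2) =
              (n / (n + 1)) * p.modelLoss l a.model * (1 / 16 * p.modelLoss l a.model) := by
            field_simp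
            ring
          have h5 : (n : ℝ) / (n + 1) ≤ 1 := (div_le_one (by positivity)).2 (by linarith)
          have h6 := hloss l a.model
          have h7 := hnn l a.model
          rw [e]
          calc _ ≤ 1 * p.modelLoss l a.model * (1 / 16 * 4) := by gcongr
            _ = _ := by ring
        have h5 : n / ((n : ℝ) + 1) * inner ℝ (p.h l - u) (p.estimate l a) =
            32 * ((n : ℝ) + 1) * n * (1 / (32 * ((n : ℝ) + 1) ^ 2) *
              inner ℝ (p.h l - u) (p.estimate l a)) := by
          field_simp
        simp only [drawSum, pathSum, List.length_cons, hw] at ih ⊢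
        rw [h5]
        push_cast
        linarith
    have h3 := mul_le_mul_of_nonneg_left h1 (by positivity : 0 ≤ 32 * ((n : ℝ) + 1) * n)
    linarith [h2 l]
  have hE' := (expectFrom_mono h.prob_nonneg (l := []) (T := T)
    (Φ := fun l => 3 / 4 * pathSum p.modelLoss l + ((-1) *
      pathSum (fun l _ => p.modelLoss l j) l + (- (4 * δ * T)
      - 32 * ((n : ℝ) + 1) * n * (n * L)))) (Ψ := drawSum w) (fun l hl => by
        have := hpath l
        rw [hl, List.length_nil, zero_add] at this
        linarith)).trans hE
  rw [expectFrom_add, expectFrom_add, expectFrom_const_mul, expectFrom_const_mul,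
    expectFrom_const (h.expectDraw_one hn)] at hE'
  have hδT : δ * T ≤ 1 / 2 := by
    rw [hδ, mul_inv, mul_right_comm, inv_mul_cancel₀ (by positivity), one_mul, inv_eq_one_div]
    gcongr
    linarith
  -- Nonnegativity of the right side allows its factor `2 / 3`, which arises in passing from `3 / 4`
  -- to `1 / 2`, to be dropped.
  have hQ : 0 ≤ p.expectFrom T [] (pathSum fun l _ => p.modelLoss l j) := by
    rw [← expectFrom_const (h.expectDraw_one hn) T [] 0]
    refine expectFrom_mono h.prob_nonneg fun l hl => ?_
    clear hl
    induction l with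
    | nil => rfl
    | cons a l ih => exact add_nonneg ih (hnn _ _)
  have hfin : 2 + 32 * ((n : ℝ) + 1) * n * (n * L) ≤ 32 * ((n : ℝ) + 1) ^ 3 * L := by
    have : 32 * ((n : ℝ) + 1) ^ 3 * L - 32 * ((n : ℝ) + 1) * n * (n * L) =
        32 * ((n + 1) * (2 * n + 1) * L) := by ring
    have h1 : 1 * (1 / 2) ≤ ((n : ℝ) + 1) * (2 * n + 1) * L := by
      gcongr
      nlinarith
    linarith
  simp only [drawSum] at hE'
  have : 0 ≤ 32 * ((n : ℝ) + 1) ^ 3 * L := by positivity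
  linarith

end IsRun

end Play

/-! ### Measurability and integrability in Nature's randomness. -/

section Random

variable {B : Type*} [NormedAddCommGroup B] [NormedSpace ℝ B] {n : ℕ}
  {S : Type*} [MeasurableSpace S] {μ : Measure S} {p : S → Play B n}

theorem aemeasurable_pathSum {c : S → History n → Fin (n + 1) → ℝ}
    (hc : ∀ l k, AEMeasurable (fun s => c s l k) μ) (l : History n) :
    AEMeasurable (fun s => pathSum (c s) l) μ := by
  induction l with
  | nil => exact aemeasurable_const
  | cons a l ih => exact ih.add (hc l a.model)

theorem abs_pathSum_le {c : History n → Fin (n + 1) → ℝ} {C : ℝ} (hc : ∀ l k, |c l k| ≤ C)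
    (l : History n) : |pathSum c l| ≤ l.length * C := by
  induction l with
  | nil => simp [pathSum]
  | cons a l ih =>
    rw [pathSum, List.length_cons]
    push_cast
    linarith [abs_add_le (pathSum c l) (c l a.model), hc l a.model]

theorem aemeasurable_expectFrom (hp : ∀ l a, AEMeasurable (fun s => (p s).prob l a) μ)
    {Φ : S → History n → ℝ} (hΦ : ∀ l, AEMeasurable (fun s => Φ s l) μ) (T : ℕ) (l : History n) :
    AEMeasurable (fun s => (p s).expectFrom T l (Φ s)) μ := by
  induction T generalizing l with
  | zero => exact hΦ l
  | succ T ih =>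
    simp only [Play.expectFrom]
    exact Finset.aemeasurable_fun_sum _ fun i _ => Finset.aemeasurable_fun_sum _ fun t _ =>
      Finset.aemeasurable_fun_sum _ fun k _ => (hp l _).mul (ih _)

theorem integrable_expectFrom [IsFiniteMeasure μ] {F : Set B} {R : B → ℝ} {η : ℝ} (hn : 1 ≤ n)
    (hrun : ∀ s, (p s).IsRun F R η) (hp : ∀ l a, AEMeasurable (fun s => (p s).prob l a) μ)
    {Φ : S → History n → ℝ} (hΦ : ∀ l, AEMeasurable (fun s => Φ s l) μ) {T : ℕ} {C : ℝ}
    (hC : ∀ s l, l.length = T → |Φ s l| ≤ C) :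
    Integrable (fun s => (p s).expectFrom T [] (Φ s)) μ := by
  refine Integrable.of_bound (aemeasurable_expectFrom hp hΦ T []).aestronglyMeasurable C
    (Filter.Eventually.of_forall fun s => ?_)
  have h1 := (hrun s).expectDraw_one hn
  rw [Real.norm_eq_abs, abs_le]
  constructor
  · rw [← Play.expectFrom_const h1 T [] (-C)]
    exact Play.expectFrom_mono (hrun s).prob_nonneg fun l hl =>
      neg_le_of_abs_le (hC s l (by simpa using hl))
  · rw [← Play.expectFrom_const h1 T [] C]
    exact Play.expectFrom_mono (hrun s).prob_nonneg fun l hl =>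
      le_of_abs_le (hC s l (by simpa using hl))

end Random

namespace Play

variable {B : Type*} [NormedAddCommGroup B] [NormedSpace ℝ B] {n : ℕ} {p : Play B n}

theorem Oblivious.pathSum_congr (h : p.Oblivious) (j : Fin (n + 1)) {l l' : History n}
    (hl : l.length = l'.length) :
    pathSum (fun l _ => p.modelLoss l j) l = pathSum (fun l _ => p.modelLoss l j) l' := by
  induction l generalizing l' with
  | nil => rw [List.eq_nil_of_length_eq_zero hl.symm]
  | cons a l ih =>
    obtain _ | ⟨a', l'⟩ := l'
    · simp at hl
    have hl' : l.length = l'.length := by simpa using hl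
    obtain ⟨hx, hM⟩ := h l l' hl'
    rw [pathSum, ih hl', pathSum, modelLoss, modelLoss, hx, hM]

/-- Against an oblivious Nature, the regret against the best model. -/
theorem IsRun.bandit_regret_of_oblivious {F : Set B} {R : B → ℝ} {η : ℝ} (h : p.IsRun F R η)
    (hob : p.Oblivious) (hn : 1 ≤ n) (hloss : ∀ l k, p.modelLoss l k ≤ 4) {T : ℕ} (hT : 1 ≤ T) :
    1 / 2 * p.expectFrom T [] (pathSum p.modelLoss) ≤
      p.expectFrom T [] (fun l => ⨅ j, pathSum (fun l _ => p.modelLoss l j) l)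
        + 32 * ((n : ℝ) + 1) ^ 3 * Real.log ((T : ℝ) * ((n : ℝ) + 1)) := by
  -- An arbitrary reference history of length `T`: against an oblivious Nature a model's total loss
  -- depends only on the length, so the best model for `l₀` is best on every path.
  let l₀ : History n := List.replicate T ⟨⟨0, hn⟩, 1, 0⟩
  obtain ⟨j, hj⟩ := exists_eq_ciInf_of_finite
    (f := fun j => pathSum (fun l _ => p.modelLoss l j) l₀)
  refine (h.bandit_regret hn hloss hT j).trans (add_le_add_left ?_ _)
  refine expectFrom_mono h.prob_nonneg fun l hl => ?_
  have hl₀ : l.length = l₀.length := by simpa [l₀] using hl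
  simp only [hob.pathSum_congr _ hl₀]
  exact hj.le

end Play

end OptimisticMD

theorem mainTheorem8
    {B : Type*} [NormedAddCommGroup B] [NormedSpace ℝ B]
    {S : Type*} [MeasurableSpace S] (μ : Measure S) [IsProbabilityMeasure μ]
    (n : ℕ) (hn : 1 ≤ n) (T : ℕ) (hT : 1 ≤ T)
    (F : Set B) (hF : Convex ℝ F) (hFball : F ⊆ Metric.closedBall 0 1)
    (X : Set (StrongDual ℝ B)) (hX : Convex ℝ X) (hXball : X ⊆ Metric.closedBall 0 1)
    (R : B → ℝ) (hR : StrongConvexOn F 1 R) (hRmax : BddAbove (R '' F))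
    (η : ℝ) (hη : 0 < η)
    (p : S → OptimisticMD.Play B n)
    (hrun : ∀ s, (p s).IsRun F R η)
    (hx : ∀ s l, (p s).x l ∈ X)
    (hM : ∀ s l k, ‖(p s).M l k‖ ≤ 1)
    (hmeas : OptimisticMD.IsMeasurablePlay μ F p)
    (fstar : B) (hfstar : fstar ∈ F) :
    (OptimisticMD.expectation μ p T
          (fun s => OptimisticMD.pathSum (fun l k => (p s).x l ((p s).f l k)))
        - OptimisticMD.expectation μ p T
          (fun s => OptimisticMD.pathSum (fun l _ => (p s).x l fstar))
      ≤ η⁻¹ * OptimisticMD.RmaxSq F R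
        + η / 2 * OptimisticMD.expectation μ p T
          (fun s => OptimisticMD.pathSum (fun l k => ‖(p s).x l - (p s).M l k‖ ^ 2)))
    ∧
    ((∀ s, (p s).Oblivious) →
      η⁻¹ * OptimisticMD.RmaxSq F R
        + η / 2 * OptimisticMD.expectation μ p T
          (fun s => OptimisticMD.pathSum (fun l k => ‖(p s).x l - (p s).M l k‖ ^ 2))
      ≤ η⁻¹ * OptimisticMD.RmaxSq F R
        + η * (OptimisticMD.expectation μ p T
            (fun s l => ⨅ j : Fin (n + 1),
              OptimisticMD.pathSum (fun l' _ => ‖(p s).x l' - (p s).M l' j‖ ^ 2) l)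
          + 32 * ((n : ℝ) + 1) ^ 3 * Real.log ((T : ℝ) * ((n : ℝ) + 1)))) := by
  have hx1 : ∀ s l, ‖(p s).x l‖ ≤ 1 := fun s l => by simpa using hXball (hx s l)
  have hF1 : ∀ v ∈ F, ‖v‖ ≤ 1 := fun v hv => by simpa using hFball hv
  have hpair : ∀ s l, ∀ v ∈ F, |(p s).x l v| ≤ 1 := fun s l v hv =>
    ((p s).x l).le_of_opNorm_le_of_le (hx1 s l) (hF1 v hv) |>.trans (by norm_num)
  have hloss : ∀ s l k, (p s).modelLoss l k ≤ 4 := fun s l k => by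
    have : ‖(p s).x l - (p s).M l k‖ ≤ 2 :=
      (norm_sub_le _ _).trans (by linarith [hx1 s l, hM s l k])
    calc (p s).modelLoss l k ≤ 2 ^ 2 := pow_le_pow_left₀ (norm_nonneg _) this 2
      _ = 4 := by norm_num
  have hloss' : ∀ s l k, |(p s).modelLoss l k| ≤ 4 := fun s l k => by
    rw [abs_of_nonneg (sq_nonneg _)]
    exact hloss s l k
  have hint_play := OptimisticMD.integrable_expectFrom (T := T) hn hrun hmeas.prob
    (OptimisticMD.aemeasurable_pathSum hmeas.play) (C := T * 1) fun s l hl => by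
      rw [← hl]
      exact OptimisticMD.abs_pathSum_le (fun l k => hpair s l _ ((hrun s).f_step l k).1) l
  have hint_star := OptimisticMD.integrable_expectFrom (T := T) hn hrun hmeas.prob
    (OptimisticMD.aemeasurable_pathSum fun l _ => hmeas.comparator l fstar hfstar)
    (C := T * 1) fun s l hl => by
      rw [← hl]
      exact OptimisticMD.abs_pathSum_le (fun l _ => hpair s l _ hfstar) l
  have hint_loss := OptimisticMD.integrable_expectFrom (T := T) hn hrun hmeas.prob
    (OptimisticMD.aemeasurable_pathSum hmeas.loss) (C := T * 4) fun s l hl => by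
      rw [← hl]
      exact OptimisticMD.abs_pathSum_le (hloss' s) l
  refine ⟨?_, fun hob => ?_⟩
  · calc _ = ∫ s, ((p s).expectFrom T []
            (OptimisticMD.pathSum fun l k => (p s).x l ((p s).f l k))
          - (p s).expectFrom T [] (OptimisticMD.pathSum fun l _ => (p s).x l fstar)) ∂μ :=
        (integral_sub hint_play hint_star).symm
      _ ≤ ∫ s, (η⁻¹ * OptimisticMD.RmaxSq F R
          + η / 2 * (p s).expectFrom T [] (OptimisticMD.pathSum (p s).modelLoss)) ∂μ := by
        refine integral_mono (hint_play.sub hint_star)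
          ((integrable_const _).add (hint_loss.const_mul _)) fun s => ?_
        have h1 := (hrun s).expectDraw_one hn
        have := OptimisticMD.Play.expectFrom_mono (hrun s).prob_nonneg (T := T) (l := [])
          fun l _ => sub_le_iff_le_add.1 ((hrun s).regret_le hη hF hR hRmax hfstar l)
        simp only [OptimisticMD.Play.expectFrom_add, OptimisticMD.Play.expectFrom_const_mul,
          OptimisticMD.Play.expectFrom_const h1] at this
        exact sub_le_iff_le_add.2 this
      _ = _ := by
        rw [integral_add (integrable_const _) (hint_loss.const_mul _), integral_const, probReal_univ,
          one_smul, integral_const_mul]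
        rfl
  · have hint_inf := OptimisticMD.integrable_expectFrom (T := T) hn hrun hmeas.prob
      (Φ := fun s l => ⨅ j : Fin (n + 1),
        OptimisticMD.pathSum (fun l' _ => (p s).modelLoss l' j) l)
      (fun l => AEMeasurable.iInf fun j =>
        OptimisticMD.aemeasurable_pathSum (fun l _ => hmeas.loss l j) l)
      (C := T * 4) fun s l hl => by
        obtain ⟨j, hj⟩ := exists_eq_ciInf_of_finite
          (f := fun j => OptimisticMD.pathSum (fun l' _ => (p s).modelLoss l' j) l)
        rw [← hj, ← hl]
        exact OptimisticMD.abs_pathSum_le (fun l _ => hloss' s l j) l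
    -- The bandit bound is applied for each realization `s` of Nature's randomness, so the best
    -- model may depend on `s` and the infimum stays inside the expectation.
    have key := integral_mono (hint_loss.const_mul (1 / 2)) (hint_inf.add (integrable_const _))
      fun s => (hrun s).bandit_regret_of_oblivious (hob s) hn (hloss s) hT
    simp only [Pi.add_apply] at key
    rw [integral_add hint_inf (integrable_const _), integral_const_mul] at key
    simp only [integral_const, probReal_univ, one_smul] at key
    have := mul_le_mul_of_nonneg_left key hη.le
    rw [← mul_assoc, mul_one_div] at this
    exact add_le_add_right this _
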